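/- Let $S,A,H$ denote the number of states, the number of actions and the horizon of a tabular episodic Markov decision process with finite state set $\mathcal S$, finite action set $\mathcal A$, transition probabilities $p_h(\cdot\mid s,a)$ for $h\in[H]=\{1,\dots,H\}$, and initial state $s_1$. For a transition function $q$ and a (possibly stochastic) policy $\pi=(\pi_h)_{h\in[H]}$, an episode starts in $s_1$ and has $a_h\sim\pi_h(\cdot\mid s_h)$ and $s_{h+1}\sim q_h(\cdot\mid s_h,a_h)$ for $h\in[H]$; let $q_h^\pi(s,a)$ be the probability that $(s_h,a_h)=(s,a)$. In each episode $t=1,2,\dots$ a learner chooses a policy $\pi^t$ from the past episodes (and possibly internal randomness), and then observes a trajectory $(s_1^t,a_1^t,\dots,s_H^t,a_H^t,s_{H+1}^t)$ whose conditional law given the past is that of an episode of $\pi^t$ under $p$. Let $n_h^t(s,a):=\sum_{j=1}^t\mathbf 1(s_h^j=s,\,a_h^j=a)$, and let $\widehat p^{\,t}$ be the maximum likelihood estimate of $p$ after $t$ episodes, i.e. $\widehat p_h^{\,t}(s'\mid s,a)=\frac{1}{n_h^t(s,a)}\sum_{j=1}^t\mathbf 1(s_h^j=s,\,a_h^j=a,\,s_{h+1}^j=s')$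 if $n_h^t(s,a)\ge 1$, and an arbitrary probability distribution on $\mathcal S$ otherwise. Write $\widehat p_h^{\,\pi,t}(s,a)$ for the visitation probability of $\pi$ under $\widehat p^{\,t}$, and $$\beta^{RF}(t,\delta):=4H^2\log(1/\delta)+24\,S H^3\log\big(A(1+t)\big).$$ **Theorem.** Let $\delta\in(0,1)$, $\mathcal Z\subseteq[H]\times\mathcal S\times\mathcal A$ and $\epsilon_0>0$ be such that $\max_\pi p_h^\pi(s,a)\le\epsilon_0$ for all $(h,s,a)\notin\mathcal Z$, the maximum being over all (stochastic) policies. Let $t_0:=\inf\{t : n_h^t(s,a)\ge 1\ \text{for all }(h,s,a)\in\mathcal Z\}$. Then, with probability at least $1-\delta$, simultaneously for all $t\ge t_0$, all choices of $\widehat p^{\,t}$ at the unvisited triplets, all deterministic policies $\pi$ and all reward functions $r\in[0,1]^{SAH}$, $$\Big|\sum_{h,s,a}\big(\widehat p_h^{\,\pi,t}(s,a)-p_h^\pi(s,a)\big)\,r_h(s,a)\Big|\le\sqrt{\beta^{RF}(t,\delta)\sum_{(h,s,a)\in\mathcal Z}\frac{p_h^\pi(s,a)^2}{n_h^t(s,a)}}+(SH-Z_\pi)\,H\,\epsilon_0,$$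 where $Z_\pi:=|\mathcal Z\cap\{(h,s,\pi_h(s)) : h\in[H],\,s\in\mathcal S\}|$. -/

import Mathlib

open MeasureTheory

noncomputable section

namespace EpisodicMDP

/-- A transition function: `p h s a` is the law of the next state when action `a` is played in
state `s` at stage `h`. The stages `1, …, H` are the elements `0, …, H - 1` of `Fin H`. -/
abbrev Transition (S A : Type*) [Fintype S] (H : ℕ) := Fin H → S → A → stdSimplex ℝ S

/-- A stochastic policy: `π h s` is the law of the action played in state `s` at stage `h`. -/
abbrev Policy (S A : Type*) [Fintype A] (H : ℕ) := Fin H → S → stdSimplex ℝ A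

/-- A deterministic policy. -/
abbrev DetPolicy (S A : Type*) (H : ℕ) := Fin H → S → A

/-- A deterministic policy seen as a stochastic one. -/
def DetPolicy.toPolicy {S A : Type*} [Fintype A] [DecidableEq A] {H : ℕ}
    (π : DetPolicy S A H) : Policy S A H :=
  fun h s => ⟨Pi.single (π h s) 1, single_mem_stdSimplex ℝ (π h s)⟩

/-- The trajectory of one episode: states `s_1, …, s_{H+1}` and actions `a_1, …, a_H`. -/
@[ext]
structure Trajectory (S A : Type*) (H : ℕ) where
  state : Fin (H + 1) → S
  action : Fin H → A

/-- Trajectories as pairs. -/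
def Trajectory.equivProd (S A : Type*) (H : ℕ) :
    Trajectory S A H ≃ (Fin (H + 1) → S) × (Fin H → A) where
  toFun τ := (τ.state, τ.action)
  invFun x := ⟨x.1, x.2⟩

instance (S A : Type*) [Fintype S] [DecidableEq S] [Fintype A] (H : ℕ) :
    Fintype (Trajectory S A H) :=
  Fintype.ofEquiv _ (Trajectory.equivProd S A H).symm

variable {S A : Type*} [Fintype S] [DecidableEq S] [Fintype A] [DecidableEq A] {H : ℕ}

/-- The probability `ℙ^π(τ)` that an episode which starts in `s₁` and follows the policy `π` under
the transition function `p` has trajectory `τ`. -/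
def trajProb (p : Transition S A H) (s₁ : S) (π : Policy S A H) (τ : Trajectory S A H) : ℝ :=
  (if τ.state 0 = s₁ then 1 else 0) *
    ∏ h : Fin H, (π h (τ.state h.castSucc)).1 (τ.action h) *
      (p h (τ.state h.castSucc) (τ.action h)).1 (τ.state h.succ)

/-- The visitation probability `p_h^π(s, a) = ℙ^π(s_h = s, a_h = a)`. -/
def occ (p : Transition S A H) (s₁ : S) (π : Policy S A H) (h : Fin H) (s : S) (a : A) : ℝ :=
  ∑ τ : Trajectory S A H with τ.state h.castSucc = s ∧ τ.action h = a, trajProb p s₁ π τ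

/-- Number of visits of `(s, a)` at stage `h` in the first `t` episodes of `X`. -/
def visits (X : ℕ → Trajectory S A H) (t : ℕ) (h : Fin H) (s : S) (a : A) : ℕ :=
  ∑ j ∈ Finset.range t, if (X j).state h.castSucc = s ∧ (X j).action h = a then 1 else 0

/-- Number of transitions from `(s, a)` at stage `h` to `s'` in the first `t` episodes of `X`. -/
def transVisits (X : ℕ → Trajectory S A H) (t : ℕ) (h : Fin H) (s : S) (a : A) (s' : S) : ℕ :=
  ∑ j ∈ Finset.range t,
    if (X j).state h.castSucc = s ∧ (X j).action h = a ∧ (X j).state h.succ = s' then 1 else 0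

/-- `q` is a maximum likelihood estimate of the transition function after the first `t` episodes:
it is given by the empirical frequencies at every visited triplet, and it is an arbitrary
probability distribution at the others, where the likelihood does not depend on it. -/
def IsEmpirical (X : ℕ → Trajectory S A H) (t : ℕ) (q : Transition S A H) : Prop :=
  ∀ h s a, visits X t h s a ≠ 0 →
    ∀ s', (q h s a).1 s' = (transVisits X t h s a s' : ℝ) / (visits X t h s a : ℝ)

/-- The first number of episodes after which every triplet of `Z` has been visited
(`⊤` if there is none). -/
def coverTime (X : ℕ → Trajectory S A H) (Z : Finset (Fin H × S × A)) : ℕ∞ :=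
  ⨅ (t : ℕ) (_ : ∀ z ∈ Z, 1 ≤ visits X t z.1 z.2.1 z.2.2), (t : ℕ∞)

/-- Interaction of a learner with the MDP. The σ-algebra `𝓕 t` is what is known after `t` episodes
(it may also hold internal randomness of the learner). Based on it, the learner chooses the policy
`π t` of the next episode, whose trajectory `X t` has conditional law `ℙ^{π t}`. -/
structure IsInteraction {Ω : Type*} {mΩ : MeasurableSpace Ω} (P : Measure Ω)
    (p : Transition S A H) (s₁ : S) (𝓕 : Filtration ℕ mΩ) (π : ℕ → Ω → Policy S A H)
    (X : ℕ → Ω → Trajectory S A H) : Prop where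
  measurable_policy : ∀ t, Measurable[𝓕 t] (π t)
  measurableSet_traj : ∀ t τ, MeasurableSet[𝓕 (t + 1)] {ω | X t ω = τ}
  condLaw : ∀ t τ, P[({ω | X t ω = τ}).indicator (fun _ => (1 : ℝ)) | 𝓕 t]
    =ᵐ[P] fun ω => trajProb p s₁ (π t ω) τ

/-- The threshold `β^RF(t, δ) = 4 H² log(1/δ) + 24 S H³ log(A (1 + t))`. -/
def betaRF (S A : Type*) [Fintype S] [Fintype A] (H t : ℕ) (δ : ℝ) : ℝ :=
  4 * (H : ℝ) ^ 2 * Real.log (1 / δ) +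
    24 * (Fintype.card S : ℝ) * (H : ℝ) ^ 3 * Real.log ((Fintype.card A : ℝ) * (1 + (t : ℝ)))

/-- `Z_π`, the number of triplets `(h, s, π_h(s))` in `Z`. -/
def cardAlong (Z : Finset (Fin H × S × A)) (π : DetPolicy S A H) : ℕ :=
  (Z.filter fun z => z.2.2 = π z.1 z.2.1).card

end EpisodicMDP

end

set_option linter.unusedSectionVars false

namespace EpisodicMDP

variable {S A : Type*} [Fintype S] [DecidableEq S] [Fintype A] [DecidableEq A] {H : ℕ}

/-! ### Episodes, one step at a time -/

/-! By the simulation lemma (`exists_value_sub_value_eq`), the error of a value is the expectation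
under the true `p` of `∑ s', (q - p) V` along the episode, where `V` is a value function of the
estimate `q`. Outside `Z`, each pair `(h, s)` costs at most `H ε₀`. On `Z` the difficulty is that
`V`, the visit counts and possibly `π` depend on the data.

The error is linear in `V`, so its maximum over a cube is attained at sign functions, of which there
are finitely many. For a fixed deterministic policy, fixed signs and fixed weights, Hoeffding's
lemma makes the compensated exponential products along the episodes a supermartingale
(`sum_trajProb_mul_exp_le_one`, `IsInteraction.integral_prod_le_one`). The best weights are
proportional to `p^π / n`. They involve the random counts, so the union bound also ranges over every
count in `{0, …, t}`. This gives `(2 A (t + 1)) ^ (S H)` events at time `t`, each controlled by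
Markov's inequality; the failure probabilities `δ / (t (t + 1))` sum to at most `δ`. Optimising the
scale (`sum_mul_le_sqrt`) turns the exponential bound at level `L` into `√(2 L ∑ p² / n)`. -/

/-- The trajectory that starts with the state `s` and the action `a` and goes on as `τ`. -/
def Trajectory.cons (s : S) (a : A) (τ : Trajectory S A H) : Trajectory S A (H + 1) :=
  ⟨Fin.cons s τ.state, Fin.cons a τ.action⟩


/-- A trajectory of length `H + 1` is a state, an action and a trajectory of length `H`. -/
def Trajectory.consEquiv (S A : Type*) (H : ℕ) :
    S × A × Trajectory S A H ≃ Trajectory S A (H + 1) where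
  toFun x := Trajectory.cons x.1 x.2.1 x.2.2
  invFun τ := (τ.state 0, τ.action 0, ⟨Fin.tail τ.state, Fin.tail τ.action⟩)
  left_inv x := by simp [Trajectory.cons]
  right_inv τ := by simp [Trajectory.cons]

theorem sum_trajectory_succ (F : Trajectory S A (H + 1) → ℝ) :
    ∑ τ, F τ = ∑ s, ∑ a, ∑ τ : Trajectory S A H, F (τ.cons s a) := by
  rw [← (Trajectory.consEquiv S A H).sum_comp, Fintype.sum_prod_type]
  simp_rw [Fintype.sum_prod_type]
  rfl

theorem trajProb_cons (p : Transition S A (H + 1)) (s₁ : S) (π : Policy S A (H + 1))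
    (s : S) (a : A) (τ : Trajectory S A H) :
    trajProb p s₁ π (τ.cons s a) = (if s = s₁ then 1 else 0) *
      ((π 0 s).1 a * (p 0 s a).1 (τ.state 0) *
        trajProb (Fin.tail p) (τ.state 0) (Fin.tail π) τ) := by
  simp [trajProb, Trajectory.cons, Fin.prod_univ_succ, Fin.tail]

/-- First step analysis of an expectation over the trajectories of an episode. -/
theorem sum_trajProb_succ (p : Transition S A (H + 1)) (s₁ : S) (π : Policy S A (H + 1))
    (F : Trajectory S A (H + 1) → ℝ) :
    ∑ τ, trajProb p s₁ π τ * F τ = ∑ a, (π 0 s₁).1 a * ∑ s', (p 0 s₁ a).1 s' *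
      ∑ τ, trajProb (Fin.tail p) s' (Fin.tail π) τ * F (τ.cons s₁ a) := by
  rw [sum_trajectory_succ]
  simp_rw [trajProb_cons]
  rw [Finset.sum_eq_single s₁ (by intro s _ hs; simp [hs]) (by simp)]
  refine Finset.sum_congr rfl fun a _ => ?_
  simp_rw [Finset.mul_sum]
  rw [Finset.sum_comm]
  refine Finset.sum_congr rfl fun τ _ => ?_
  -- The inner `trajProb` only charges trajectories that start in `s'`.
  rw [Finset.sum_eq_single (τ.state 0)]
  · simp only [if_true]; ring
  · intro s' _ hs'
    simp [trajProb, hs'.symm]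
  · simp

theorem trajProb_nonneg (p : Transition S A H) (s₁ : S) (π : Policy S A H)
    (τ : Trajectory S A H) : 0 ≤ trajProb p s₁ π τ := by
  refine mul_nonneg (by split_ifs <;> simp) (Finset.prod_nonneg fun h _ => ?_)
  exact mul_nonneg ((π _ _).2.1 _) ((p _ _ _).2.1 _)

theorem sum_trajectory_zero (p : Transition S A 0) (s₁ : S) (π : Policy S A 0)
    (F : Trajectory S A 0 → ℝ) :
    ∑ τ, trajProb p s₁ π τ * F τ = F ⟨fun _ => s₁, Fin.elim0⟩ := by
  rw [Finset.sum_eq_single ⟨fun _ => s₁, Fin.elim0⟩]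
  · simp [trajProb]
  · intro τ _ hτ
    rw [trajProb, if_neg, zero_mul, zero_mul]
    intro h0
    refine hτ (Trajectory.ext ?_ ?_)
    · ext i; rw [Fin.fin_one_eq_zero i]; exact h0
    · ext i; exact i.elim0
  · simp

/-- If every transition has exponential moment at most one, so has the whole episode. -/
theorem sum_trajProb_mul_exp_le_one : ∀ {H : ℕ} (p : Transition S A H) (s₁ : S) (π : Policy S A H)
    (g : Fin H → S → A → S → ℝ) (_ : ∀ h s a, ∑ s', (p h s a).1 s' * Real.exp (g h s a s') ≤ 1),
    ∑ τ, trajProb p s₁ π τ *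
      Real.exp (∑ h, g h (τ.state h.castSucc) (τ.action h) (τ.state h.succ)) ≤ 1
  | 0, p, s₁, π, g, _ => by rw [sum_trajectory_zero]; simp
  | H + 1, p, s₁, π, g, hg => by
    rw [sum_trajProb_succ]
    calc _ ≤ ∑ a, (π 0 s₁).1 a * 1 := by
          refine Finset.sum_le_sum fun a _ => mul_le_mul_of_nonneg_left ?_ ((π 0 s₁).2.1 a)
          refine le_trans (Finset.sum_le_sum fun s' _ => ?_) (hg 0 s₁ a)
          refine mul_le_mul_of_nonneg_left ?_ ((p 0 s₁ a).2.1 s')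
          have key := sum_trajProb_mul_exp_le_one (Fin.tail p) s' (Fin.tail π) (Fin.tail g)
            fun h s a => hg h.succ s a
          calc _ = ∑ τ, Real.exp (g 0 s₁ a s') * (trajProb (Fin.tail p) s' (Fin.tail π) τ *
                Real.exp (∑ h, Fin.tail g h (τ.state h.castSucc) (τ.action h)
                  (τ.state h.succ))) := by
                refine Finset.sum_congr rfl fun τ _ => ?_
                by_cases h0 : τ.state 0 = s'
                · rw [Fin.sum_univ_succ, Real.exp_add]
                  simp only [Trajectory.cons, Fin.castSucc_zero, Fin.cons_zero, Fin.succ_zero_eq_one,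
                    Fin.cons_succ, ← Fin.succ_castSucc, Fin.tail]
                  rw [show (1 : Fin (H + 2)) = Fin.succ 0 from rfl, Fin.cons_succ, h0]
                  ring
                · simp [trajProb, h0]
            _ ≤ _ := by
                rw [← Finset.mul_sum]
                exact mul_le_of_le_one_right (Real.exp_pos _).le key
      _ = 1 := by simp [(π 0 s₁).2.2]

/-! ### Visitation probabilities and the simulation lemma -/

theorem occ_eq_sum (p : Transition S A H) (s₁ : S) (π : Policy S A H) (h : Fin H) (s : S) (a : A) :
    occ p s₁ π h s a = ∑ τ, trajProb p s₁ π τ *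
      if τ.state h.castSucc = s ∧ τ.action h = a then 1 else 0 := by
  simp [occ, Finset.sum_filter]

theorem sum_trajProb : ∀ {H : ℕ} (p : Transition S A H) (s₁ : S) (π : Policy S A H),
    ∑ τ, trajProb p s₁ π τ = 1
  | 0, p, s₁, π => by simpa using sum_trajectory_zero p s₁ π fun _ => 1
  | H + 1, p, s₁, π => by
    have := sum_trajProb_succ p s₁ π fun _ => 1
    simp only [mul_one, sum_trajProb (Fin.tail p), (p 0 s₁ _).2.2, (π 0 s₁).2.2] at this
    exact this

theorem occ_nonneg (p : Transition S A H) (s₁ : S) (π : Policy S A H) (h : Fin H) (s : S) (a : A) :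
    0 ≤ occ p s₁ π h s a :=
  Finset.sum_nonneg fun τ _ => trajProb_nonneg p s₁ π τ

theorem occ_zero (p : Transition S A (H + 1)) (s₁ : S) (π : Policy S A (H + 1)) (s : S) (a : A) :
    occ p s₁ π 0 s a = if s₁ = s then (π 0 s₁).1 a else 0 := by
  rw [occ_eq_sum, sum_trajProb_succ]
  simp only [Trajectory.cons, Fin.castSucc_zero, Fin.cons_zero, ← Finset.sum_mul, sum_trajProb,
    one_mul, (p 0 s₁ _).2.2]
  by_cases h : s₁ = s <;> simp [h]

theorem occ_succ (p : Transition S A (H + 1)) (s₁ : S) (π : Policy S A (H + 1)) (h : Fin H)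
    (s : S) (a : A) :
    occ p s₁ π h.succ s a = ∑ b, (π 0 s₁).1 b * ∑ s', (p 0 s₁ b).1 s' *
      occ (Fin.tail p) s' (Fin.tail π) h s a := by
  simp only [occ_eq_sum, sum_trajProb_succ p, Trajectory.cons, ← Fin.succ_castSucc, Fin.cons_succ]

/-- The expected sum of `f` along an episode. -/
def value (p : Transition S A H) (s₁ : S) (π : Policy S A H) (f : Fin H → S → A → ℝ) : ℝ :=
  ∑ h, ∑ s, ∑ a, occ p s₁ π h s a * f h s a

/-- The Bellman equation: stage `0` only visits `s₁`, and later visits are obtained by conditioning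
on the first action and transition. -/
theorem value_succ (p : Transition S A (H + 1)) (s₁ : S) (π : Policy S A (H + 1))
    (f : Fin (H + 1) → S → A → ℝ) :
    value p s₁ π f = ∑ a, (π 0 s₁).1 a * (f 0 s₁ a + ∑ s', (p 0 s₁ a).1 s' *
      value (Fin.tail p) s' (Fin.tail π) (Fin.tail f)) := by
  have h0 : ∑ s, ∑ a, occ p s₁ π 0 s a * f 0 s a = ∑ a, (π 0 s₁).1 a * f 0 s₁ a := by
    simp_rw [occ_zero]
    rw [Finset.sum_eq_single s₁ (by intro s _ hs; simp [hs.symm]) (by simp)]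
    simp
  have h1 : ∀ h : Fin H, ∑ s, ∑ a, occ p s₁ π h.succ s a * f h.succ s a =
      ∑ b, (π 0 s₁).1 b * ∑ s', (p 0 s₁ b).1 s' *
        ∑ s, ∑ a, occ (Fin.tail p) s' (Fin.tail π) h s a * f h.succ s a := by
    intro h
    simp_rw [occ_succ, Finset.mul_sum, Finset.sum_mul]
    have e : ∀ T : S → A → A → S → ℝ, ∑ s, ∑ a, ∑ b, ∑ s', T s a b s' =
        ∑ b, ∑ s', ∑ s, ∑ a, T s a b s' := by
      intro T
      have e1 : ∀ s, ∑ a, ∑ b, ∑ s', T s a b s' = ∑ b, ∑ s', ∑ a, T s a b s' := fun s => by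
        rw [Finset.sum_comm]
        exact Finset.sum_congr rfl fun b _ => Finset.sum_comm
      simp_rw [e1]
      rw [Finset.sum_comm]
      exact Finset.sum_congr rfl fun b _ => Finset.sum_comm
    rw [e]
    refine Finset.sum_congr rfl fun b _ => Finset.sum_congr rfl fun s' _ =>
      Finset.sum_congr rfl fun s _ => Finset.sum_congr rfl fun a _ => ?_
    ring
  rw [value, Fin.sum_univ_succ, h0]
  simp_rw [h1, mul_add, Finset.sum_add_distrib]
  congr 1
  rw [Finset.sum_comm]
  refine Finset.sum_congr rfl fun b _ => ?_
  rw [← Finset.mul_sum, Finset.sum_comm]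
  simp_rw [← Finset.mul_sum]
  rfl

theorem value_mem_Icc : ∀ {H : ℕ} (p : Transition S A H) (s₁ : S) (π : Policy S A H)
    (r : Fin H → S → A → ℝ) (_ : ∀ h s a, r h s a ∈ Set.Icc (0 : ℝ) 1),
    value p s₁ π r ∈ Set.Icc (0 : ℝ) H
  | 0, p, s₁, π, r, _ => by simp [value]
  | H + 1, p, s₁, π, r, hr => by
    rw [value_succ]
    have ih := fun s' => value_mem_Icc (Fin.tail p) s' (Fin.tail π) (Fin.tail r)
      fun h s a => hr h.succ s a
    have hs : ∀ a, ∑ s', (p 0 s₁ a).1 s' * value (Fin.tail p) s' (Fin.tail π) (Fin.tail r) ≤ H := by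
      intro a
      refine (Finset.sum_le_sum fun s' _ =>
        mul_le_mul_of_nonneg_left (ih s').2 ((p 0 s₁ a).2.1 s')).trans ?_
      rw [← Finset.sum_mul, (p 0 s₁ a).2.2, one_mul]
    constructor
    · exact Finset.sum_nonneg fun a _ => mul_nonneg ((π 0 s₁).2.1 a) (add_nonneg (hr 0 s₁ a).1
        (Finset.sum_nonneg fun s' _ => mul_nonneg ((p 0 s₁ a).2.1 s') (ih s').1))
    · refine (Finset.sum_le_sum fun a _ => mul_le_mul_of_nonneg_left
        (add_le_add (hr 0 s₁ a).2 (hs a)) ((π 0 s₁).2.1 a)).trans ?_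
      rw [← Finset.sum_mul, (π 0 s₁).2.2]
      push_cast
      linarith

/-- The simulation lemma: `V h` is the value function of stage `h + 1` under `q`. -/
theorem exists_value_sub_value_eq : ∀ {H : ℕ} (p q : Transition S A H) (π : Policy S A H)
    (r : Fin H → S → A → ℝ) (_ : ∀ h s a, r h s a ∈ Set.Icc (0 : ℝ) 1),
    ∃ V : Fin H → S → ℝ, (∀ h s, V h s ∈ Set.Icc (0 : ℝ) H) ∧
      ∀ s₁, value q s₁ π r - value p s₁ π r = value p s₁ π fun h s a =>
        ∑ s', ((q h s a).1 s' - (p h s a).1 s') * V h s'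
  | 0, p, q, π, r, _ => ⟨Fin.elim0, fun h => h.elim0, fun s₁ => by simp [value]⟩
  | H + 1, p, q, π, r, hr => by
    have hr' : ∀ h s a, Fin.tail r h s a ∈ Set.Icc (0 : ℝ) 1 := fun h s a => hr h.succ s a
    obtain ⟨V, hV, hd⟩ := exists_value_sub_value_eq (Fin.tail p) (Fin.tail q) (Fin.tail π)
      (Fin.tail r) hr'
    refine ⟨Fin.cons (fun s' => value (Fin.tail q) s' (Fin.tail π) (Fin.tail r)) V, ?_, ?_⟩
    · intro h s
      have hle : (H : ℝ) ≤ ((H + 1 : ℕ) : ℝ) := by push_cast; linarith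
      refine Set.Icc_subset_Icc_right hle ?_
      refine Fin.cases ?_ (fun h => ?_) h
      · exact value_mem_Icc _ _ _ _ hr'
      · exact hV h s
    · intro s₁
      -- Subtract the two Bellman equations and write `q V^q - p V^p = (q - p) V^q + p (V^q - V^p)`:
      -- the first term is the stage `0` error, the second is the induction hypothesis averaged
      -- under `p`.
      rw [value_succ q, value_succ p _ _ r, value_succ p, ← Finset.sum_sub_distrib]
      refine Finset.sum_congr rfl fun a _ => ?_
      rw [← mul_sub, add_sub_add_left_eq_sub, ← Finset.sum_sub_distrib]
      simp only [Fin.cons_zero]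
      rw [← Finset.sum_add_distrib]
      congr 1
      refine Finset.sum_congr rfl fun s' _ => ?_
      have := hd s'
      have e : (Fin.tail fun (h : Fin (H + 1)) s a => ∑ s', ((q h s a).1 s' - (p h s a).1 s') *
          (Fin.cons (fun s' => value (Fin.tail q) s' (Fin.tail π) (Fin.tail r)) V :
            Fin (H + 1) → S → ℝ) h s') = fun h s a =>
          ∑ s', ((Fin.tail q h s a).1 s' - (Fin.tail p h s a).1 s') * V h s' := by
        ext h s a
        simp [Fin.tail]
      rw [e, ← this]
      ring

theorem occ_toPolicy_of_ne : ∀ {H : ℕ} (p : Transition S A H) (s₁ : S) (π : DetPolicy S A H)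
    (h : Fin H) (s : S) {a : A} (_ : a ≠ π h s), occ p s₁ π.toPolicy h s a = 0 := by
  intro H p s₁ π h s a ha
  refine Finset.sum_eq_zero fun τ hτ => ?_
  obtain ⟨rfl, rfl⟩ := (Finset.mem_filter.1 hτ).2
  rw [trajProb, Finset.prod_eq_zero (Finset.mem_univ h), mul_zero]
  simp [DetPolicy.toPolicy, ha]

theorem value_toPolicy (p : Transition S A H) (s₁ : S) (π : DetPolicy S A H)
    (f : Fin H → S → A → ℝ) :
    value p s₁ π.toPolicy f =
      ∑ x : Fin H × S, occ p s₁ π.toPolicy x.1 x.2 (π x.1 x.2) * f x.1 x.2 (π x.1 x.2) := by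
  rw [value, Fintype.sum_prod_type]
  refine Finset.sum_congr rfl fun h _ => Finset.sum_congr rfl fun s _ => ?_
  refine Finset.sum_eq_single _ (fun a _ ha => ?_) (by simp)
  rw [occ_toPolicy_of_ne p s₁ π h s ha, zero_mul]

/-! ### Exponential moments -/

/-- Hoeffding's lemma for a finitely supported law and a function with values in `[-1, 1]`. -/
theorem sum_mul_exp_le_one (p : stdSimplex ℝ S) (v : S → ℝ) (hv : ∀ s, v s ∈ Set.Icc (-1 : ℝ) 1)
    (l : ℝ) :
    ∑ s', p.1 s' * Real.exp (l * (v s' - ∑ s, p.1 s * v s) - l ^ 2 / 2) ≤ 1 := by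
  let _ : MeasurableSpace S := ⊤
  have hsum : ∑ s, ENNReal.ofReal (p.1 s) = 1 := by
    rw [← ENNReal.ofReal_sum_of_nonneg fun s _ => p.2.1 s, p.2.2, ENNReal.ofReal_one]
  set μ := (PMF.ofFintype (fun s => ENNReal.ofReal (p.1 s)) hsum).toMeasure with hμ
  have hint : ∀ f : S → ℝ, ∫ s, f s ∂μ = ∑ s, p.1 s * f s := by
    intro f
    rw [hμ, PMF.integral_eq_sum]
    simp [ENNReal.toReal_ofReal (p.2.1 _)]
  have hh := ProbabilityTheory.hasSubgaussianMGF_of_mem_Icc (μ := μ) (X := v) (a := -1) (b := 1)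
    measurable_from_top.aemeasurable (Filter.Eventually.of_forall hv)
  have h1 := hh.mgf_le l
  rw [ProbabilityTheory.mgf, hint, hint] at h1
  -- The variance proxy of a variable in `[-1, 1]` is one, whence the compensator `l ^ 2 / 2`.
  have h2 : ((‖(1 : ℝ) - -1‖₊ / 2) ^ 2 : NNReal) = 1 := by
    have : ‖(1 : ℝ) - -1‖₊ = 2 := by ext; norm_num
    rw [this]; norm_num
  rw [h2] at h1
  simp_rw [Real.exp_sub _ (l ^ 2 / 2), ← mul_div_assoc]
  rw [← Finset.sum_div, div_le_one (Real.exp_pos _)]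
  simpa using h1

/-! ### Supermartingale bound along the episodes -/

section Interaction

variable {Ω : Type*} {mΩ : MeasurableSpace Ω} {P : Measure Ω} [IsProbabilityMeasure P]
  {p : Transition S A H} {s₁ : S} {𝓕 : Filtration ℕ mΩ} {πs : ℕ → Ω → Policy S A H}
  {X : ℕ → Ω → Trajectory S A H}

/-- The law of an episode is only specified on the events `X t = τ`; this finite expansion carries
measurability and conditional expectations over to any function of the trajectory. -/
theorem comp_traj_eq_sum (f : Trajectory S A H → ℝ) (t : ℕ) (ω : Ω) :
    f (X t ω) = ∑ τ, f τ * ({ω | X t ω = τ}).indicator (fun _ => (1 : ℝ)) ω := by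
  classical
  simp [Set.indicator_apply]

theorem IsInteraction.measurable_comp (hX : IsInteraction P p s₁ 𝓕 πs X)
    (f : Trajectory S A H → ℝ) (t : ℕ) : Measurable[𝓕 (t + 1)] fun ω => f (X t ω) := by
  simp_rw [comp_traj_eq_sum f t]
  exact Finset.measurable_sum _ fun τ _ =>
    (measurable_const.indicator (hX.measurableSet_traj t τ)).const_mul _

theorem IsInteraction.measurable_prod (hX : IsInteraction P p s₁ 𝓕 πs X)
    (f : Trajectory S A H → ℝ) (t : ℕ) :
    Measurable[𝓕 t] fun ω => ∏ j ∈ Finset.range t, f (X j ω) :=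
  Finset.measurable_prod _ fun j hj =>
    (hX.measurable_comp f j).mono (𝓕.mono (Finset.mem_range.1 hj)) le_rfl

theorem IsInteraction.integrable_prod (hX : IsInteraction P p s₁ 𝓕 πs X)
    (f : Trajectory S A H → ℝ) (t : ℕ) :
    Integrable (fun ω => ∏ j ∈ Finset.range t, f (X j ω)) P := by
  refine Integrable.of_bound (C := (∑ τ, |f τ|) ^ t)
    ((hX.measurable_prod f t).mono (𝓕.le t) le_rfl).aestronglyMeasurable
    (Filter.Eventually.of_forall fun ω => ?_)
  rw [norm_prod]
  refine (Finset.prod_le_prod (g := fun _ => ∑ τ, |f τ|) (fun j _ => norm_nonneg _)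
    fun j _ => ?_).trans_eq (by simp)
  exact Finset.single_le_sum (f := fun τ => |f τ|) (fun τ _ => abs_nonneg _) (Finset.mem_univ _)

/-- If `f ≥ 0` has mean at most one under every policy, the product of the values of `f` along the
episodes has mean at most one. -/
theorem IsInteraction.integral_prod_le_one (hX : IsInteraction P p s₁ 𝓕 πs X)
    (f : Trajectory S A H → ℝ) (hf0 : ∀ τ, 0 ≤ f τ)
    (hf : ∀ π, ∑ τ, trajProb p s₁ π τ * f τ ≤ 1) (t : ℕ) :
    ∫ ω, ∏ j ∈ Finset.range t, f (X j ω) ∂P ≤ 1 := by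
  induction t with
  | zero => simp
  | succ t ih =>
    -- Given `𝓕 t`, the product `M` is known and the new factor has conditional mean at most one.
    -- The policy `πs t ω` is random, which is why `hf` is needed for every policy.
    refine le_trans ?_ ih
    set M : Ω → ℝ := fun ω => ∏ j ∈ Finset.range t, f (X j ω) with hM
    have hMm : StronglyMeasurable[𝓕 t] M := (hX.measurable_prod f t).stronglyMeasurable
    have hMi : Integrable M P := hX.integrable_prod f t
    have hM0 : ∀ ω, 0 ≤ M ω := fun ω => Finset.prod_nonneg fun j _ => hf0 _
    have hset : ∀ τ, MeasurableSet {ω | X t ω = τ} := fun τ =>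
      𝓕.le (t + 1) _ (hX.measurableSet_traj t τ)
    set I : Trajectory S A H → Ω → ℝ := fun τ => ({ω | X t ω = τ}).indicator fun _ => 1 with hI
    have hIi : ∀ τ, Integrable (I τ) P := fun τ => (integrable_const 1).indicator (hset τ)
    have hMI : ∀ τ, Integrable (M * I τ) P := by
      intro τ
      refine (hMi.indicator (hset τ)).congr (Filter.Eventually.of_forall fun ω => ?_)
      by_cases h : X t ω = τ <;> simp [hI, h]
    have hce : ∀ τ, P[M * I τ | 𝓕 t] =ᵐ[P] fun ω => M ω * trajProb p s₁ (πs t ω) τ := by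
      intro τ
      filter_upwards [condExp_mul_of_stronglyMeasurable_left hMm (hMI τ) (hIi τ), hX.condLaw t τ]
        with ω h1 h2
      rw [h1, Pi.mul_apply, h2]
    -- Integrability comes for free from the almost sure equality with a conditional expectation.
    have hint : ∀ τ, Integrable (fun ω => M ω * trajProb p s₁ (πs t ω) τ) P := fun τ =>
      integrable_condExp.congr (hce τ)
    calc ∫ ω, ∏ j ∈ Finset.range (t + 1), f (X j ω) ∂P
        = ∫ ω, ∑ τ, f τ * (M * I τ) ω ∂P := by
          refine integral_congr_ae (Filter.Eventually.of_forall fun ω => ?_)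
          simp only [Finset.prod_range_succ]
          rw [comp_traj_eq_sum f t, Finset.mul_sum]
          refine Finset.sum_congr rfl fun τ _ => ?_
          simp only [Pi.mul_apply, hM, hI]
          ring
      _ = ∑ τ, f τ * ∫ ω, M ω * trajProb p s₁ (πs t ω) τ ∂P := by
          rw [integral_finsetSum _ fun τ _ => (hMI τ).const_mul _]
          refine Finset.sum_congr rfl fun τ _ => ?_
          rw [integral_const_mul, ← integral_congr_ae (hce τ), integral_condExp (𝓕.le t)]
      _ = ∫ ω, M ω * ∑ τ, trajProb p s₁ (πs t ω) τ * f τ ∂P := by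
          simp_rw [← integral_const_mul]
          rw [← integral_finsetSum _ fun τ _ => (hint τ).const_mul _]
          refine integral_congr_ae (Filter.Eventually.of_forall fun ω => ?_)
          simp only [Finset.mul_sum]
          exact Finset.sum_congr rfl fun τ _ => by ring
      _ ≤ ∫ ω, M ω ∂P := by
          refine integral_mono_of_nonneg (Filter.Eventually.of_forall fun ω => ?_) hMi
            (Filter.Eventually.of_forall fun ω => ?_)
          · exact mul_nonneg (hM0 ω) (Finset.sum_nonneg fun τ _ =>
              mul_nonneg (trajProb_nonneg _ _ _ _) (hf0 τ))
          · exact mul_le_of_le_one_right (hM0 ω) (hf _)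

/-- Markov's inequality for the products along the episodes. -/
theorem IsInteraction.measureReal_le_exp_neg (hX : IsInteraction P p s₁ 𝓕 πs X)
    (f : Trajectory S A H → ℝ) (hf0 : ∀ τ, 0 ≤ f τ)
    (hf : ∀ π, ∑ τ, trajProb p s₁ π τ * f τ ≤ 1) (t : ℕ) (L : ℝ) :
    P.real {ω | Real.exp L ≤ ∏ j ∈ Finset.range t, f (X j ω)} ≤ Real.exp (-L) := by
  have h := mul_meas_ge_le_integral_of_nonneg (μ := P)
    (Filter.Eventually.of_forall fun ω => Finset.prod_nonneg fun j _ => hf0 (X j ω))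
    (hX.integrable_prod f t) (Real.exp L)
  rw [Real.exp_neg, ← one_div, le_div_iff₀ (Real.exp_pos _), mul_comm]
  exact h.trans (hX.integral_prod_le_one f hf0 hf t)

end Interaction

/-! ### The exponential tilt attached to a deterministic policy -/

/-- The compensated exponent of one step: it is active when the action is that of `π`, with weight
`l h s` and test function `v h`. -/
noncomputable def tilt (p : Transition S A H) (π : DetPolicy S A H) (l v : Fin H → S → ℝ)
    (h : Fin H) (s : S) (a : A) (s' : S) : ℝ :=
  if a = π h s then l h s * (v h s' - ∑ x, (p h s (π h s)).1 x * v h x) - l h s ^ 2 / 2 else 0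

/-- The learner need not follow `π`: a step with another action has zero tilt, hence moment exactly
one. -/
theorem sum_mul_exp_tilt_le_one (p : Transition S A H) (π : DetPolicy S A H) (l v : Fin H → S → ℝ)
    (hv : ∀ h s, v h s ∈ Set.Icc (-1 : ℝ) 1) (h : Fin H) (s : S) (a : A) :
    ∑ s', (p h s a).1 s' * Real.exp (tilt p π l v h s a s') ≤ 1 := by
  by_cases ha : a = π h s
  · subst ha
    simpa only [tilt, if_true] using sum_mul_exp_le_one (p h s (π h s)) (v h) (hv h) (l h s)
  · simp [tilt, ha, (p h s a).2.2]

/-- The exponential of the sum of the tilts along a trajectory. -/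
noncomputable def expTilt (p : Transition S A H) (π : DetPolicy S A H) (l v : Fin H → S → ℝ)
    (τ : Trajectory S A H) : ℝ :=
  Real.exp (∑ h, tilt p π l v h (τ.state h.castSucc) (τ.action h) (τ.state h.succ))

/-- At an unvisited triplet both counts vanish, so the arbitrary value of `q` there is harmless. -/
theorem transVisits_eq_visits_mul {X : ℕ → Trajectory S A H} {t : ℕ} {q : Transition S A H}
    (hq : IsEmpirical X t q) (h : Fin H) (s : S) (a : A) (s' : S) :
    (transVisits X t h s a s' : ℝ) = visits X t h s a * (q h s a).1 s' := by
  have hle : transVisits X t h s a s' ≤ visits X t h s a := by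
    refine Finset.sum_le_sum fun j _ => ?_
    split_ifs with h1 h2 <;> simp_all
  by_cases h0 : visits X t h s a = 0
  · rw [h0] at hle ⊢
    simp [Nat.le_zero.1 hle]
  · rw [hq h s a h0 s']
    field_simp

theorem tilt_eq_sum (p : Transition S A H) (π : DetPolicy S A H) (l v : Fin H → S → ℝ) (h : Fin H)
    (τ : Trajectory S A H) :
    tilt p π l v h (τ.state h.castSucc) (τ.action h) (τ.state h.succ) =
      ∑ s, ∑ s', ((if τ.state h.castSucc = s ∧ τ.action h = π h s ∧ τ.state h.succ = s' then 1
        else 0 : ℕ) : ℝ) * (l h s * (v h s' - ∑ x, (p h s (π h s)).1 x * v h x) - l h s ^ 2 / 2) := by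
  rw [Finset.sum_eq_single (τ.state h.castSucc) (by intro s _ hs; simp [hs.symm]) (by simp),
    Finset.sum_eq_single (τ.state h.succ) (by intro s _ hs; simp [hs.symm]) (by simp)]
  by_cases ha : τ.action h = π h (τ.state h.castSucc) <;> simp [tilt, ha]

/-- The accumulated tilt in terms of the empirical transition function. -/
theorem prod_expTilt (p : Transition S A H) (π : DetPolicy S A H) (l v : Fin H → S → ℝ)
    {X : ℕ → Trajectory S A H} {t : ℕ} {q : Transition S A H} (hq : IsEmpirical X t q) :
    ∏ j ∈ Finset.range t, expTilt p π l v (X j) = Real.exp (∑ x : Fin H × S,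
      (visits X t x.1 x.2 (π x.1 x.2) : ℝ) *
        (l x.1 x.2 * ∑ s', ((q x.1 x.2 (π x.1 x.2)).1 s' - (p x.1 x.2 (π x.1 x.2)).1 s') * v x.1 s'
          - l x.1 x.2 ^ 2 / 2)) := by
  simp only [expTilt]
  rw [← Real.exp_sum, Finset.sum_comm, Fintype.sum_prod_type]
  congr 1
  refine Finset.sum_congr rfl fun h _ => ?_
  simp_rw [tilt_eq_sum]
  rw [Finset.sum_comm]
  refine Finset.sum_congr rfl fun s _ => ?_
  rw [Finset.sum_comm]
  have e : ∀ s', ∑ j ∈ Finset.range t, ((if (X j).state h.castSucc = s ∧ (X j).action h = π h s ∧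
      (X j).state h.succ = s' then 1 else 0 : ℕ) : ℝ) =
      visits X t h s (π h s) * (q h s (π h s)).1 s' := fun s' => by
    rw [← transVisits_eq_visits_mul hq, transVisits, Nat.cast_sum]
  simp_rw [← Finset.sum_mul, e, mul_assoc]
  rw [← Finset.mul_sum]
  congr 1
  -- The part that does not depend on `s'` is multiplied by `∑ s', q = 1`.
  have e1 : ∀ s', (q h s (π h s)).1 s' * (l h s * (v h s' - ∑ x, (p h s (π h s)).1 x * v h x) -
      l h s ^ 2 / 2) = l h s * ((q h s (π h s)).1 s' * v h s') - (q h s (π h s)).1 s' *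
      (l h s * ∑ x, (p h s (π h s)).1 x * v h x + l h s ^ 2 / 2) := fun s' => by ring
  simp_rw [e1, Finset.sum_sub_distrib, ← Finset.sum_mul, (q h s (π h s)).2.2, sub_mul,
    Finset.sum_sub_distrib, ← Finset.mul_sum]
  ring

/-- Optimisation of the exponential bound over the scale of the tilt. -/
theorem sum_mul_le_sqrt {ι : Type*} (K : Finset ι) (w n y : ι → ℝ) (hn : ∀ i ∈ K, 0 < n i)
    {L : ℝ} (hL : 0 < L) (η : ℝ) (hη : η = √(2 * L / ∑ i ∈ K, w i ^ 2 / n i))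
    (h : ∑ i ∈ K, n i * (η * w i / n i * y i - (η * w i / n i) ^ 2 / 2) ≤ L) :
    ∑ i ∈ K, w i * y i ≤ √(2 * L * ∑ i ∈ K, w i ^ 2 / n i) := by
  set W := ∑ i ∈ K, w i ^ 2 / n i with hW
  have hterm : ∀ i ∈ K, 0 ≤ w i ^ 2 / n i := fun i hi => div_nonneg (sq_nonneg _) (hn i hi).le
  have hW0 : 0 ≤ W := Finset.sum_nonneg hterm
  rcases hW0.eq_or_lt with h0 | h0
  · have hz := (Finset.sum_eq_zero_iff_of_nonneg hterm).1 h0.symm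
    rw [Finset.sum_eq_zero fun i hi => ?_]
    · exact Real.sqrt_nonneg _
    · have := (div_eq_zero_iff.1 (hz i hi)).resolve_right (hn i hi).ne'
      rw [pow_eq_zero_iff two_ne_zero] at this
      rw [this, zero_mul]
  · have hη0 : 0 < η := by rw [hη]; positivity
    have hη2 : η ^ 2 * W = 2 * L := by
      rw [hη, Real.sq_sqrt (by positivity)]; field_simp
    have e : ∑ i ∈ K, n i * (η * w i / n i * y i - (η * w i / n i) ^ 2 / 2) =
        η * ∑ i ∈ K, w i * y i - η ^ 2 * W / 2 := by
      rw [hW, Finset.mul_sum, Finset.mul_sum, Finset.sum_div, ← Finset.sum_sub_distrib]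
      refine Finset.sum_congr rfl fun i hi => ?_
      have := (hn i hi).ne'
      field_simp
    -- Since `η ^ 2 * W = 2 * L`, the resulting bound `(L + η ^ 2 * W / 2) / η` is `η * W`.
    have hs : √(2 * L * W) = η * W := by
      rw [← hη2, show η ^ 2 * W * W = (η * W) ^ 2 by ring, Real.sqrt_sq (by positivity)]
    rw [hs]
    refine le_of_mul_le_mul_left ?_ hη0
    nlinarith

/-! ### The union bound -/

/-- The pairs `(h, s)` such that `(h, s, π_h(s))` lies in `Z`. -/
def along (Z : Finset (Fin H × S × A)) (π : DetPolicy S A H) : Finset (Fin H × S) :=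
  {x | (x.1, x.2, π x.1 x.2) ∈ Z}

theorem filter_eq_map_along (Z : Finset (Fin H × S × A)) (π : DetPolicy S A H) :
    (Z.filter fun z => z.2.2 = π z.1 z.2.1) = (along Z π).map
      ⟨fun x => (x.1, x.2, π x.1 x.2), fun x y hxy => by
        simp only [Prod.mk.injEq] at hxy; exact Prod.ext hxy.1 hxy.2.1⟩ := by
  ext ⟨h, s, a⟩
  simp only [along, Finset.mem_filter, Finset.mem_map, Finset.mem_univ, true_and, Prod.exists]
  constructor
  · rintro ⟨hz, rfl⟩
    exact ⟨h, s, hz, rfl⟩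
  · rintro ⟨h', s', hz, he⟩
    have he' : (h', s', π h' s') = (h, s, a) := he
    obtain ⟨rfl, rfl, rfl⟩ : h' = h ∧ s' = s ∧ π h' s' = a := by simpa using he'
    exact ⟨hz, rfl⟩

theorem cardAlong_eq (Z : Finset (Fin H × S × A)) (π : DetPolicy S A H) :
    cardAlong Z π = (along Z π).card := by
  rw [cardAlong, filter_eq_map_along, Finset.card_map]

/-- The visitation probability of `(h, s)` under a deterministic policy. -/
noncomputable def stateOcc (p : Transition S A H) (s₁ : S) (π : DetPolicy S A H) (x : Fin H × S) : ℝ :=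
  occ p s₁ π.toPolicy x.1 x.2 (π x.1 x.2)

/-- Triplets of `Z` whose action is not that of `π` are never visited by `π`. -/
theorem sum_occ_sq_div (p : Transition S A H) (s₁ : S) (Z : Finset (Fin H × S × A))
    (π : DetPolicy S A H) (n : Fin H → S → A → ℝ) :
    ∑ z ∈ Z, occ p s₁ π.toPolicy z.1 z.2.1 z.2.2 ^ 2 / n z.1 z.2.1 z.2.2 =
      ∑ x ∈ along Z π, stateOcc p s₁ π x ^ 2 / n x.1 x.2 (π x.1 x.2) := by
  rw [← Finset.sum_filter_of_ne (p := fun z => z.2.2 = π z.1 z.2.1), filter_eq_map_along,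
    Finset.sum_map]
  · rfl
  · intro z _ hz
    by_contra hne
    exact hz (by rw [occ_toPolicy_of_ne p s₁ π _ _ hne]; simp)

/-- The optimal scale of the tilt at level `L` for the policy `π` and the visit counts `N`. -/
noncomputable def tiltScale (p : Transition S A H) (s₁ : S) (Z : Finset (Fin H × S × A)) (L : ℝ)
    (π : DetPolicy S A H) (N : Fin H → S → ℝ) : ℝ :=
  √(2 * L / ∑ x ∈ along Z π, stateOcc p s₁ π x ^ 2 / N x.1 x.2)

/-- The optimal weights of the tilt at level `L` for the policy `π` and the visit counts `N`. -/
noncomputable def tiltWeight (p : Transition S A H) (s₁ : S) (Z : Finset (Fin H × S × A)) (L : ℝ)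
    (π : DetPolicy S A H) (N : Fin H → S → ℝ) (h : Fin H) (s : S) : ℝ :=
  if (h, s) ∈ along Z π then tiltScale p s₁ Z L π N * stateOcc p s₁ π (h, s) / N h s else 0

/-- The `±1`-valued function with given signs. -/
noncomputable def signFun (σ : Fin H → S → Bool) (h : Fin H) (s : S) : ℝ := if σ h s then 1 else -1

theorem signFun_mem_Icc (σ : Fin H → S → Bool) (h : Fin H) (s : S) :
    signFun σ h s ∈ Set.Icc (-1 : ℝ) 1 := by
  rw [signFun]; split_ifs <;> simp

/-- What the union bound ranges over at time `t`: a deterministic policy, possible visit counts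
along it and signs. -/
abbrev UnionIndex (S A : Type*) (H t : ℕ) :=
  (Fin H → S → A) × (Fin H → S → Fin (t + 1)) × (Fin H → S → Bool)

theorem card_unionIndex (t : ℕ) : Fintype.card (UnionIndex S A H t) =
    (Fintype.card A * (t + 1) * 2) ^ (Fintype.card S * H) := by
  simp only [Fintype.card_prod, Fintype.card_fun, Fintype.card_fin, Fintype.card_bool]
  rw [← pow_mul, ← pow_mul, ← pow_mul, mul_pow, mul_pow, mul_assoc]

/-- The tilted likelihood of one episode attached to an index of the union bound. -/
noncomputable def indexTilt (p : Transition S A H) (s₁ : S) (Z : Finset (Fin H × S × A)) (L : ℝ) {t : ℕ}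
    (i : UnionIndex S A H t) : Trajectory S A H → ℝ :=
  expTilt p i.1 (tiltWeight p s₁ Z L i.1 fun h s => ((i.2.1 h s : ℕ) : ℝ)) (signFun i.2.2)

/-- The concentration event for the data `X` at time `t` and level `L`. -/
def Concentrated (p : Transition S A H) (s₁ : S) (Z : Finset (Fin H × S × A)) (L : ℝ) (t : ℕ)
    (X : ℕ → Trajectory S A H) : Prop :=
  ∀ i : UnionIndex S A H t, ∏ j ∈ Finset.range t, indexTilt p s₁ Z L i (X j) < Real.exp L

theorem visits_le (X : ℕ → Trajectory S A H) (t : ℕ) (h : Fin H) (s : S) (a : A) :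
    visits X t h s a ≤ t := by
  refine (Finset.sum_le_card_nsmul _ _ 1 fun j _ => ?_).trans_eq (by simp)
  split_ifs <;> simp

/-- The realised counts are among the indices of the union bound, so the inequality may be used with
the data-dependent optimal weights. -/
theorem Concentrated.sum_le {p q : Transition S A H} {s₁ : S} {Z : Finset (Fin H × S × A)} {L : ℝ}
    {t : ℕ} {X : ℕ → Trajectory S A H} (hc : Concentrated p s₁ Z L t X) (hL : 0 < L)
    (hq : IsEmpirical X t q) (hZ : ∀ z ∈ Z, 1 ≤ visits X t z.1 z.2.1 z.2.2)
    (π : DetPolicy S A H) (σ : Fin H → S → Bool) :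
    ∑ x ∈ along Z π, stateOcc p s₁ π x *
        ∑ s', ((q x.1 x.2 (π x.1 x.2)).1 s' - (p x.1 x.2 (π x.1 x.2)).1 s') * signFun σ x.1 s' ≤
      √(2 * L * ∑ x ∈ along Z π, stateOcc p s₁ π x ^ 2 /
        (visits X t x.1 x.2 (π x.1 x.2) : ℝ)) := by
  have hi := hc ⟨π, fun h s => ⟨visits X t h s (π h s), Nat.lt_succ_of_le (visits_le X t h s _)⟩, σ⟩
  simp only [indexTilt] at hi
  rw [prod_expTilt p π _ _ hq, Real.exp_lt_exp] at hi
  refine sum_mul_le_sqrt (along Z π) _ _ _ (fun x hx => ?_) hL _ rfl (le_trans (le_of_eq ?_) hi.le)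
  · have : (x.1, x.2, π x.1 x.2) ∈ Z := by simpa [along] using hx
    exact_mod_cast hZ _ this
  · rw [← Finset.sum_subset (Finset.subset_univ (along Z π))]
    · refine Finset.sum_congr rfl fun x hx => ?_
      simp only [tiltWeight, Prod.mk.eta, hx, if_true, tiltScale]
    · intro x _ hx
      simp [tiltWeight, hx]

/-- The part of the error on `Z`, for test functions with values in `[0, b]`. -/
theorem Concentrated.abs_sum_le {p q : Transition S A H} {s₁ : S} {Z : Finset (Fin H × S × A)}
    {L : ℝ} {t : ℕ} {X : ℕ → Trajectory S A H} (hc : Concentrated p s₁ Z L t X) (hL : 0 < L)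
    (hq : IsEmpirical X t q) (hZ : ∀ z ∈ Z, 1 ≤ visits X t z.1 z.2.1 z.2.2)
    (π : DetPolicy S A H) {b : ℝ} (hb : 0 ≤ b) (V : Fin H → S → ℝ) (hV : ∀ h s, |V h s| ≤ b) :
    |∑ x ∈ along Z π, stateOcc p s₁ π x *
        ∑ s', ((q x.1 x.2 (π x.1 x.2)).1 s' - (p x.1 x.2 (π x.1 x.2)).1 s') * V x.1 s'| ≤
      b * √(2 * L * ∑ x ∈ along Z π, stateOcc p s₁ π x ^ 2 /
        (visits X t x.1 x.2 (π x.1 x.2) : ℝ)) := by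
  set c : Fin H → S → ℝ := fun h s' => ∑ s, if (h, s) ∈ along Z π then stateOcc p s₁ π (h, s) *
    ((q h s (π h s)).1 s' - (p h s (π h s)).1 s') else 0 with hcdef
  have hlin : ∀ U : Fin H → S → ℝ, ∑ x ∈ along Z π, stateOcc p s₁ π x *
      ∑ s', ((q x.1 x.2 (π x.1 x.2)).1 s' - (p x.1 x.2 (π x.1 x.2)).1 s') * U x.1 s' =
      ∑ h, ∑ s', c h s' * U h s' := by
    intro U
    have e : along Z π = Finset.univ.filter (· ∈ along Z π) := by simp
    rw [e, Finset.sum_filter, Fintype.sum_prod_type]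
    refine Finset.sum_congr rfl fun h _ => ?_
    simp_rw [hcdef, Finset.sum_mul]
    rw [Finset.sum_comm]
    refine Finset.sum_congr rfl fun s _ => ?_
    split_ifs with hx
    · rw [Finset.mul_sum]
      exact Finset.sum_congr rfl fun s' _ => (mul_assoc _ _ _).symm
    · simp
  rw [hlin]
  -- The worst test function takes the sign of each coefficient `c h s'`. These signs depend on the
  -- data, which is allowed since all signs are covered.
  have hsign := hc.sum_le hL hq hZ π fun h s => decide (0 ≤ c h s)
  rw [hlin] at hsign
  refine le_trans ?_ (mul_le_mul_of_nonneg_left hsign hb)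
  rw [Finset.mul_sum]
  refine (Finset.abs_sum_le_sum_abs _ _).trans (Finset.sum_le_sum fun h _ => ?_)
  rw [Finset.mul_sum]
  refine (Finset.abs_sum_le_sum_abs _ _).trans (Finset.sum_le_sum fun s' _ => ?_)
  rw [abs_mul, mul_comm]
  have : c h s' * signFun (fun h s => decide (0 ≤ c h s)) h s' = |c h s'| := by
    by_cases h0 : 0 ≤ c h s'
    · simp [signFun, h0, abs_of_nonneg h0]
    · simp [signFun, h0, abs_of_neg (not_le.1 h0)]
  rw [this]
  exact mul_le_mul_of_nonneg_right (hV h s') (abs_nonneg _)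

/-- The level of the union bound at time `t`. -/
noncomputable def level (S A : Type*) [Fintype S] [Fintype A] (H t : ℕ) (δ : ℝ) : ℝ :=
  Real.log (1 / δ) +
    4 * ((Fintype.card S * H : ℕ) : ℝ) * Real.log ((Fintype.card A : ℝ) * (1 + (t : ℝ)))

theorem level_pos [Nonempty A] (t : ℕ) {δ : ℝ} (hδ0 : 0 < δ) (hδ1 : δ < 1) :
    0 < level S A H t δ := by
  have hA : (1 : ℝ) ≤ Fintype.card A := by exact_mod_cast Fintype.card_pos
  have ht : (0 : ℝ) ≤ t := t.cast_nonneg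
  have h1 : 0 < Real.log (1 / δ) := Real.log_pos (by rw [lt_div_iff₀ hδ0]; linarith)
  have h2 : 0 ≤ Real.log ((Fintype.card A : ℝ) * (1 + (t : ℝ))) := Real.log_nonneg (by nlinarith)
  exact add_pos_of_pos_of_nonneg h1 (by positivity)

/-- The left side is `2 H² log (1/δ) + 8 S H³ log (A (1 + t))`, so there is slack in both constants.
-/
theorem two_mul_sq_mul_level_le [Nonempty A] (t : ℕ) {δ : ℝ} (hδ0 : 0 < δ) (hδ1 : δ < 1) :
    (H : ℝ) ^ 2 * (2 * level S A H t δ) ≤ betaRF S A H t δ := by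
  have hA : (1 : ℝ) ≤ Fintype.card A := by exact_mod_cast Fintype.card_pos
  have ht : (0 : ℝ) ≤ t := t.cast_nonneg
  have h1 : 0 ≤ Real.log (1 / δ) := (Real.log_pos (by rw [lt_div_iff₀ hδ0]; linarith)).le
  have h2 : 0 ≤ Real.log ((Fintype.card A : ℝ) * (1 + (t : ℝ))) := Real.log_nonneg (by nlinarith)
  have h3 : 0 ≤ (H : ℝ) ^ 2 * Real.log (1 / δ) := by positivity
  have h4 : 0 ≤ (Fintype.card S : ℝ) * (H : ℝ) ^ 3 *
      Real.log ((Fintype.card A : ℝ) * (1 + (t : ℝ))) := by positivity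
  rw [level, betaRF]
  push_cast
  nlinarith

/-- With `a = A (1 + t)` and `m = S H`, the level supplies a factor `a ^ (-4 m)`. Half of it pays
for the `(2 a) ^ m` indices, because `a ≥ 2` when `t ≥ 1`; the other half pays for `t (t + 1)`. -/
theorem card_unionIndex_mul_exp_le [Nonempty S] [Nonempty A] (hH : 0 < H) {t : ℕ} (ht : 1 ≤ t)
    {δ : ℝ} (hδ0 : 0 < δ) :
    (Fintype.card (UnionIndex S A H t) : ℝ) * Real.exp (-level S A H t δ) ≤
      δ / (t * (t + 1)) := by
  have hA : (1 : ℝ) ≤ Fintype.card A := by exact_mod_cast Fintype.card_pos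
  have ht' : (1 : ℝ) ≤ t := by exact_mod_cast ht
  have hm : 1 ≤ Fintype.card S * H := Nat.mul_pos Fintype.card_pos hH
  rw [card_unionIndex, level]
  push_cast
  set m := Fintype.card S * H with hmdef
  set a : ℝ := Fintype.card A * (1 + (t : ℝ)) with ha
  have hat : 1 + (t : ℝ) ≤ a := by rw [ha]; nlinarith
  have ha0 : 0 < a := by linarith
  have hexp : Real.exp (-(Real.log (1 / δ) + 4 * (m : ℝ) * Real.log a)) = δ / a ^ (4 * m) := by
    rw [show 4 * (m : ℝ) * Real.log a = Real.log (a ^ (4 * m)) by rw [Real.log_pow]; push_cast; ring,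
      ← Real.log_mul (by positivity) (pow_pos ha0 _).ne', Real.exp_neg, Real.exp_log (by positivity)]
    field_simp
  have hcast : ((Fintype.card S : ℝ) * (H : ℝ)) = (m : ℝ) := by rw [hmdef]; push_cast; rfl
  rw [hcast, hexp, ← mul_div_assoc, div_le_div_iff₀ (by positivity) (by positivity)]
  have h1 : ((Fintype.card A : ℝ) * (t + 1) * 2) ^ m ≤ a ^ (2 * m) := by
    rw [pow_mul a]
    refine pow_le_pow_left₀ (by positivity) ?_ m
    rw [ha]
    nlinarith
  have h2 : (t : ℝ) * (t + 1) ≤ a ^ (2 * m) := by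
    refine le_trans ?_ (pow_le_pow_right₀ (by linarith) (show 2 ≤ 2 * m by omega))
    nlinarith
  calc ((Fintype.card A : ℝ) * (t + 1) * 2) ^ m * δ * (t * (t + 1))
      ≤ a ^ (2 * m) * δ * a ^ (2 * m) := by gcongr
    _ = δ * a ^ (4 * m) := by rw [show 4 * m = 2 * m + 2 * m by ring, pow_add]; ring

/-- The sum telescopes. -/
theorem sum_div_mul_succ_le {δ : ℝ} (hδ0 : 0 ≤ δ) (n : ℕ) :
    ∑ k ∈ Finset.range n, δ / (((k + 1 : ℕ) : ℝ) * (((k + 1 : ℕ) : ℝ) + 1)) ≤ δ := by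
  have h : ∑ k ∈ Finset.range n, δ / (((k + 1 : ℕ) : ℝ) * (((k + 1 : ℕ) : ℝ) + 1)) =
      δ - δ / (n + 1) := by
    induction n with
    | zero => simp
    | succ n ih =>
      rw [Finset.sum_range_succ, ih]
      push_cast
      field_simp
      ring
  rw [h]
  exact sub_le_self _ (by positivity)

/-! ### Concentration simultaneously at all times -/

section Interaction

variable {Ω : Type*} {mΩ : MeasurableSpace Ω} {P : Measure Ω} [IsProbabilityMeasure P]
  {p : Transition S A H} {s₁ : S} {𝓕 : Filtration ℕ mΩ} {πs : ℕ → Ω → Policy S A H}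
  {X : ℕ → Ω → Trajectory S A H}

theorem IsInteraction.measurableSet_concentrated (hX : IsInteraction P p s₁ 𝓕 πs X)
    (Z : Finset (Fin H × S × A)) (L : ℝ) (t : ℕ) :
    MeasurableSet {ω | Concentrated p s₁ Z L t fun j => X j ω} := by
  simp only [Concentrated, Set.ofPred_forall]
  exact MeasurableSet.iInter fun i => measurableSet_lt
    ((hX.measurable_prod _ t).mono (𝓕.le t) le_rfl) measurable_const

/-- The union bound for finitely many products along the episodes. -/
theorem IsInteraction.measureReal_exists_le (hX : IsInteraction P p s₁ 𝓕 πs X) {ι : Type*}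
    [Fintype ι] (f : ι → Trajectory S A H → ℝ) (hf0 : ∀ i τ, 0 ≤ f i τ)
    (hf : ∀ i π, ∑ τ, trajProb p s₁ π τ * f i τ ≤ 1) (t : ℕ) (L : ℝ) :
    P.real {ω | ∃ i, Real.exp L ≤ ∏ j ∈ Finset.range t, f i (X j ω)} ≤
      Fintype.card ι * Real.exp (-L) := by
  rw [Set.ofPred_exists]
  refine (measureReal_iUnion_fintype_le _).trans ((Finset.sum_le_card_nsmul _ _ (Real.exp (-L))
    fun i _ => hX.measureReal_le_exp_neg (f i) (hf0 i) (hf i) t L).trans_eq ?_)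
  rw [Finset.card_univ, nsmul_eq_mul]

theorem IsInteraction.measureReal_not_concentrated_le (hX : IsInteraction P p s₁ 𝓕 πs X)
    (Z : Finset (Fin H × S × A)) (L : ℝ) (t : ℕ) :
    P.real {ω | ¬ Concentrated p s₁ Z L t fun j => X j ω} ≤
      Fintype.card (UnionIndex S A H t) * Real.exp (-L) := by
  have h := hX.measureReal_exists_le (fun i : UnionIndex S A H t => indexTilt p s₁ Z L i)
    (fun i τ => (Real.exp_pos _).le) (fun i π => sum_trajProb_mul_exp_le_one p s₁ π _ fun h s a =>
      sum_mul_exp_tilt_le_one p _ _ _ (signFun_mem_Icc _) h s a) t L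
  simpa only [Concentrated, not_forall, not_lt] using h

/-- With probability at least `1 - δ`, concentration holds at all times. -/
theorem IsInteraction.exists_concentrated (hX : IsInteraction P p s₁ 𝓕 πs X) [Nonempty A]
    (hH : 0 < H) (Z : Finset (Fin H × S × A)) {δ : ℝ} (hδ0 : 0 < δ) :
    ∃ E : Set Ω, MeasurableSet E ∧ 1 - δ ≤ P.real E ∧ ∀ ω ∈ E, ∀ t, 1 ≤ t →
      Concentrated p s₁ Z (level S A H t δ) t fun j => X j ω := by
  have : Nonempty S := ⟨s₁⟩
  -- `B k` is the failure at time `k + 1`: the cardinality estimate needs at least one episode.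
  set B : ℕ → Set Ω := fun k =>
    {ω | ¬ Concentrated p s₁ Z (level S A H (k + 1) δ) (k + 1) fun j => X j ω} with hB
  have hBm : ∀ k, MeasurableSet (B k) := fun k =>
    (hX.measurableSet_concentrated Z (level S A H (k + 1) δ) (k + 1)).compl
  have hUm : MeasurableSet (⋃ k, B k) := MeasurableSet.iUnion hBm
  refine ⟨(⋃ k, B k)ᶜ, hUm.compl, ?_, ?_⟩
  · have hP : P (⋃ k, B k) ≤ ENNReal.ofReal δ := by
      refine (measure_iUnion_le B).trans (ENNReal.tsum_le_of_sum_range_le fun n => ?_)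
      calc ∑ k ∈ Finset.range n, P (B k)
          ≤ ∑ k ∈ Finset.range n,
              ENNReal.ofReal (δ / (((k + 1 : ℕ) : ℝ) * (((k + 1 : ℕ) : ℝ) + 1))) := by
            refine Finset.sum_le_sum fun k _ => ?_
            rw [← ofReal_measureReal]
            exact ENNReal.ofReal_le_ofReal ((hX.measureReal_not_concentrated_le Z _ _).trans
              (card_unionIndex_mul_exp_le hH (Nat.le_add_left 1 k) hδ0))
        _ = ENNReal.ofReal (∑ k ∈ Finset.range n,
              δ / (((k + 1 : ℕ) : ℝ) * (((k + 1 : ℕ) : ℝ) + 1))) :=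
            (ENNReal.ofReal_sum_of_nonneg fun k _ => by positivity).symm
        _ ≤ ENNReal.ofReal δ := ENNReal.ofReal_le_ofReal (sum_div_mul_succ_le hδ0.le n)
    rw [measureReal_compl hUm, probReal_univ]
    exact sub_le_sub_left (ENNReal.toReal_le_of_le_ofReal hδ0.le hP) 1
  · intro ω hω t ht
    by_contra hc
    refine hω (Set.mem_iUnion.2 ⟨t - 1, ?_⟩)
    simpa only [hB, Set.mem_ofPred_eq, Nat.sub_add_cancel ht] using hc

end Interaction

/-! ### Cover time and error outside `Z` -/

theorem visits_mono (X : ℕ → Trajectory S A H) (h : Fin H) (s : S) (a : A) :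
    Monotone fun t => visits X t h s a := fun _ _ htt' =>
  Finset.sum_le_sum_of_subset (Finset.range_mono htt')

/-- Counts are nondecreasing, so a triplet of `Z` unvisited at time `t` forces the cover time to be
at least `t + 1`. -/
theorem one_le_visits_of_coverTime_le {X : ℕ → Trajectory S A H} {Z : Finset (Fin H × S × A)}
    {t : ℕ} (h : coverTime X Z ≤ t) : ∀ z ∈ Z, 1 ≤ visits X t z.1 z.2.1 z.2.2 := by
  intro z hz
  by_contra hlt
  have : ((t + 1 : ℕ) : ℕ∞) ≤ coverTime X Z := by
    refine le_iInf₂ fun t' ht' => ?_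
    by_contra hle
    have : t' ≤ t := by
      have := not_le.1 hle
      norm_cast at this
      omega
    exact hlt ((ht' z hz).trans (visits_mono X _ _ _ this))
  have := this.trans h
  norm_cast at this
  omega

/-- The part of the error outside `Z`. -/
theorem abs_sum_compl_along_le (p q : Transition S A H) (s₁ : S) (Z : Finset (Fin H × S × A))
    {ε₀ : ℝ} (hZ : ∀ h s a, (h, s, a) ∉ Z → ∀ π : Policy S A H, occ p s₁ π h s a ≤ ε₀)
    (π : DetPolicy S A H) (V : Fin H → S → ℝ) {b : ℝ} (hb : 0 ≤ b)
    (hV : ∀ h s, V h s ∈ Set.Icc (0 : ℝ) b) :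
    |∑ x ∈ (along Z π)ᶜ, stateOcc p s₁ π x *
        ∑ s', ((q x.1 x.2 (π x.1 x.2)).1 s' - (p x.1 x.2 (π x.1 x.2)).1 s') * V x.1 s'| ≤
      ((Fintype.card S : ℝ) * H - cardAlong Z π) * b * ε₀ := by
  -- Both means of `V` lie in `[0, b]`, so they differ by at most `b`; bounding them separately
  -- would lose a factor two.
  have hmean : ∀ (m : stdSimplex ℝ S) h, ∑ s', m.1 s' * V h s' ∈ Set.Icc (0 : ℝ) b := by
    intro m h
    refine ⟨Finset.sum_nonneg fun s' _ => mul_nonneg (m.2.1 s') (hV h s').1, ?_⟩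
    refine (Finset.sum_le_sum fun s' _ =>
      mul_le_mul_of_nonneg_left (hV h s').2 (m.2.1 s')).trans_eq ?_
    rw [← Finset.sum_mul, m.2.2, one_mul]
  refine (Finset.abs_sum_le_sum_abs _ _).trans
    ((Finset.sum_le_card_nsmul _ _ (b * ε₀) fun x hx => ?_).trans_eq ?_)
  · have hocc : stateOcc p s₁ π x ≤ ε₀ :=
      hZ _ _ _ (by simpa [along] using hx) _
    rw [abs_mul, mul_comm, stateOcc, abs_of_nonneg (occ_nonneg _ _ _ _ _ _)]
    refine mul_le_mul ?_ hocc (occ_nonneg _ _ _ _ _ _) hb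
    simp_rw [sub_mul, Finset.sum_sub_distrib]
    have h1 := hmean (q x.1 x.2 (π x.1 x.2)) x.1
    have h2 := hmean (p x.1 x.2 (π x.1 x.2)) x.1
    rw [abs_le]
    constructor <;> linarith [h1.1, h1.2, h2.1, h2.2]
  · rw [nsmul_eq_mul, Finset.card_compl, Nat.cast_sub (Finset.card_le_univ _), cardAlong_eq,
      Fintype.card_prod, Fintype.card_fin]
    push_cast
    ring

end EpisodicMDP

/-! ### The deviation bound -/

theorem mainTheorem6 {S A : Type*} [Fintype S] [DecidableEq S] [Fintype A] [DecidableEq A]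
    {H : ℕ} (p : EpisodicMDP.Transition S A H) (s₁ : S)
    {Ω : Type*} {mΩ : MeasurableSpace Ω} (P : Measure Ω) [IsProbabilityMeasure P]
    (𝓕 : Filtration ℕ mΩ) (πs : ℕ → Ω → EpisodicMDP.Policy S A H)
    (X : ℕ → Ω → EpisodicMDP.Trajectory S A H)
    (hX : EpisodicMDP.IsInteraction P p s₁ 𝓕 πs X)
    (δ : ℝ) (hδ0 : 0 < δ) (hδ1 : δ < 1)
    (Z : Finset (Fin H × S × A)) (ε₀ : ℝ) (hε₀ : 0 < ε₀)
    (hZ : ∀ h s a, (h, s, a) ∉ Z →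
      ∀ π : EpisodicMDP.Policy S A H, EpisodicMDP.occ p s₁ π h s a ≤ ε₀) :
    ∃ E : Set Ω, MeasurableSet E ∧ 1 - δ ≤ P.real E ∧
      ∀ ω ∈ E, ∀ t : ℕ, EpisodicMDP.coverTime (fun j => X j ω) Z ≤ (t : ℕ∞) →
        ∀ q : EpisodicMDP.Transition S A H, EpisodicMDP.IsEmpirical (fun j => X j ω) t q →
        ∀ π : EpisodicMDP.DetPolicy S A H,
        ∀ r : Fin H → S → A → ℝ, (∀ h s a, r h s a ∈ Set.Icc (0 : ℝ) 1) →
          |∑ h, ∑ s, ∑ a, (EpisodicMDP.occ q s₁ π.toPolicy h s a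
              - EpisodicMDP.occ p s₁ π.toPolicy h s a) * r h s a|
            ≤ √(EpisodicMDP.betaRF S A H t δ *
                ∑ z ∈ Z, EpisodicMDP.occ p s₁ π.toPolicy z.1 z.2.1 z.2.2 ^ 2
                  / (EpisodicMDP.visits (fun j => X j ω) t z.1 z.2.1 z.2.2 : ℝ))
              + ((Fintype.card S : ℝ) * (H : ℝ) - (EpisodicMDP.cardAlong Z π : ℝ)) * (H : ℝ) * ε₀
    := by
  open EpisodicMDP in
  -- For `H = 0` the set of actions may be empty, but all sums vanish.
  rcases Nat.eq_zero_or_pos H with rfl | hH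
  · exact ⟨Set.univ, MeasurableSet.univ, by simp [hδ0.le], fun ω _ t _ q _ π r _ => by simp⟩
  obtain ⟨ω₀⟩ := nonempty_of_isProbabilityMeasure P
  have : Nonempty A := ⟨(X 0 ω₀).action ⟨0, hH⟩⟩
  obtain ⟨E, hEm, hEP, hE⟩ := hX.exists_concentrated hH Z hδ0
  refine ⟨E, hEm, hEP, fun ω hω t ht q hq π r hr => ?_⟩
  have hvis := one_le_visits_of_coverTime_le ht
  obtain ⟨V, hV, hdiff⟩ := exists_value_sub_value_eq p q π.toPolicy r hr
  have hval : ∑ h, ∑ s, ∑ a, (occ q s₁ π.toPolicy h s a - occ p s₁ π.toPolicy h s a) * r h s a =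
      ∑ x ∈ along Z π, stateOcc p s₁ π x *
        ∑ s', ((q x.1 x.2 (π x.1 x.2)).1 s' - (p x.1 x.2 (π x.1 x.2)).1 s') * V x.1 s' +
      ∑ x ∈ (along Z π)ᶜ, stateOcc p s₁ π x *
        ∑ s', ((q x.1 x.2 (π x.1 x.2)).1 s' - (p x.1 x.2 (π x.1 x.2)).1 s') * V x.1 s' := by
    rw [Finset.sum_add_sum_compl]
    refine Eq.trans ?_ ((hdiff s₁).trans (value_toPolicy p s₁ π _))
    simp only [value, sub_mul, Finset.sum_sub_distrib]
  rw [hval, sum_occ_sq_div p s₁ Z π fun h s a => (visits (fun j => X j ω) t h s a : ℝ)]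
  refine (abs_add_le _ _).trans (add_le_add ?_
    (abs_sum_compl_along_le p q s₁ Z hZ π V (Nat.cast_nonneg H) hV))
  -- At `t = 0` nothing has been visited, so a cover time of zero leaves no term on `Z`.
  rcases Nat.eq_zero_or_pos t with rfl | ht1
  · have hempty : along Z π = ∅ := by
      refine Finset.eq_empty_of_forall_notMem fun x hx => ?_
      have := hvis (x.1, x.2, π x.1 x.2) (by simpa [along] using hx)
      simp [visits] at this
    simp [hempty]
  · refine ((hE ω hω t ht1).abs_sum_le (level_pos t hδ0 hδ1) hq hvis π (Nat.cast_nonneg H) V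
      fun h s => by rw [abs_of_nonneg (hV h s).1]; exact (hV h s).2).trans ?_
    refine Real.le_sqrt_of_sq_le ?_
    have hL := level_pos (S := S) (A := A) (H := H) t hδ0 hδ1
    have hW : 0 ≤ ∑ x ∈ along Z π, stateOcc p s₁ π x ^ 2 /
        (visits (fun j => X j ω) t x.1 x.2 (π x.1 x.2) : ℝ) :=
      Finset.sum_nonneg fun x _ => by positivity
    rw [mul_pow, Real.sq_sqrt (by positivity), ← mul_assoc]
    exact mul_le_mul_of_nonneg_right (two_mul_sq_mul_level_le t hδ0 hδ1) hW
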